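/- Let $C_n$ denote the $n$-th Catalan number. For integers $1\le m\le U$ let $S=\{s_1<\dots<s_m\}$ be a random $m$-element subset of $\{1,\dots,U\}$ with $$\Pr[S=\{s_1,\dots,s_m\}]=\frac{1}{M(U,m)}\prod_{j=0}^{m}C_{s_{j+1}-s_j-1},\qquad s_0=0,\quad s_{m+1}=U+1,$$ where $M(U,m)=\sum_{0<s_1<\dots<s_m<U+1}\prod_{j=0}^{m}C_{s_{j+1}-s_j-1}$ is the normalizing constant. Let $B\ge 2$ be an integer with $U\le B$, let $k=\log^4 B$ (the logarithm being to a fixed base $b>1$) and $L=\lfloor m^2/k\rfloor$, and assume $L\ge 1$. Let $\Delta$ be uniformly random in $\{1,\dots,L\}$ and independent of $S$, and divide $\{1,\dots,U\}$ into the intervals $[\Delta+jL,\Delta+(j+1)L)$, $j\in\mathbb Z$, that is, the $j$ with $-1\le j\le\lfloor U/L\rfloor$ (the other intervals contain no point of $\{1,\dots,U\}$). **Lemma.** Suppose that $U=\Theta(m^2)$, that is, $\alpha m^2\le U\le\beta m^2$ with constants $0<\alpha\le\beta$. Then there is a constant $C>0$ depending only on $b,\alpha,\beta$ such that, for all $B,U,m$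 as above and every real $l$ with $0<l\le m/\sqrt k$ (note that $m/\sqrt k=O(\sqrt L)$), the expected number, over $S$ and $\Delta$, of intervals that contain at least $l/2$ and at most $l$ points of $S$ is at most $$C\left(\frac{lk}{m}+1\right).$$ -/

import Mathlib

namespace CatalanBlock

open scoped Classical in
/-- The increasing sequences `0 = s_0 < s_1 < ⋯ < s_m < s_{m+1} = U + 1` of integers. Such a
sequence is the same thing as an `m`-element subset `{s_1, …, s_m}` of `{1, …, U}`. -/
noncomputable def configs (U m : ℕ) : Finset (Fin (m + 2) → Fin (U + 2)) :=
  Finset.univ.filter fun s => StrictMono s ∧ s 0 = 0 ∧ s (Fin.last (m + 1)) = Fin.last (U + 1)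

/-- The weight `∏_{j=0}^m C_{s_{j+1} - s_j - 1}`, where `C_n` is the `n`-th Catalan number. -/
def weight {U m : ℕ} (s : Fin (m + 2) → Fin (U + 2)) : ℕ :=
  ∏ j : Fin (m + 1), catalan ((s j.succ : ℕ) - (s j.castSucc : ℕ) - 1)

/-- `M(U, m)`, the sum of the weights of all the `m`-element subsets of `{1, …, U}`. -/
noncomputable def total (U m : ℕ) : ℕ := ∑ s ∈ configs U m, weight s

/-- `Pr[S = {s_1, …, s_m}]`. -/
noncomputable def pr {U m : ℕ} (s : Fin (m + 2) → Fin (U + 2)) : ℝ :=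
  (weight s : ℝ) / (total U m : ℝ)

/-- The set `S = {s_1, …, s_m}` (without the sentinels `s_0` and `s_{m+1}`). -/
def points {U m : ℕ} (s : Fin (m + 2) → Fin (U + 2)) : Finset ℕ :=
  Finset.univ.image fun i : Fin m => (s i.succ.castSucc : ℕ)

/-- The number of elements of `S` in the interval `[Δ + j L, Δ + (j + 1) L)`. -/
def intervalCount (S : Finset ℕ) (L Δ : ℕ) (j : ℤ) : ℕ :=
  (S.filter fun x : ℕ => (Δ : ℤ) + j * L ≤ x ∧ (x : ℤ) < Δ + (j + 1) * L).card

/-- The number of intervals `[Δ + j L, Δ + (j + 1) L)` that contain at least `l / 2` and at most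
`l` elements of `S`. For `S ⊆ {1, …, U}` and `1 ≤ Δ ≤ L`, the intervals with
`-1 ≤ j ≤ ⌊U / L⌋` cover `{1, …, U}`, and all the others contain no element of `S`. -/
noncomputable def smallIntervals (U L : ℕ) (l : ℝ) (S : Finset ℕ) (Δ : ℕ) : ℕ :=
  ((Finset.Icc (-1 : ℤ) ((U / L : ℕ) : ℤ)).filter fun j =>
    l / 2 ≤ (intervalCount S L Δ j : ℝ) ∧ (intervalCount S L Δ j : ℝ) ≤ l).card

/-- The expectation of `smallIntervals`, where `S` has the law `pr` and `Δ` is independent of `S`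
and uniform in `{1, …, L}`. -/
noncomputable def expectedSmallIntervals (U m L : ℕ) (l : ℝ) : ℝ :=
  ∑ s ∈ configs U m, pr s *
    ((∑ Δ ∈ Finset.Icc 1 L, (smallIntervals U L l (points s) Δ : ℝ)) / (L : ℝ))

theorem catalan_pos (n : ℕ) : 0 < catalan n := by
  have h := succ_mul_catalan_eq_centralBinom n
  have h2 := Nat.centralBinom_pos n
  rcases Nat.eq_zero_or_pos (catalan n) with h0 | h0
  · simp [h0] at h
    omega
  · exact h0

theorem configs_nonempty {U m : ℕ} (h : m ≤ U) : (configs U m).Nonempty := by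
  refine ⟨fun j => if hj : (j : ℕ) ≤ m then ⟨j, by omega⟩ else Fin.last (U + 1), ?_⟩
  simp only [configs, Finset.mem_filter, Finset.mem_univ, true_and]
  refine ⟨?_, ?_, ?_⟩
  · intro i j hij
    have h1 : (i : ℕ) < j := hij
    have h2 := j.2
    have h3 : (i : ℕ) ≤ m := by omega
    by_cases hj : (j : ℕ) ≤ m
    · simp only [h3, hj, dif_pos]
      exact h1
    · simp only [h3, hj, dif_pos, dif_neg, not_false_eq_true]
      refine Fin.mk_lt_mk.2 ?_
      omega
  · simp
  · simp

/-- `pr` is a probability distribution on the `m`-element subsets of `{1, …, U}`. -/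
theorem sum_pr {U m : ℕ} (h : m ≤ U) : ∑ s ∈ configs U m, pr s = 1 := by
  have hpos : 0 < total U m :=
    Finset.sum_pos (fun s _ => Finset.prod_pos fun j _ => catalan_pos _) (configs_nonempty h)
  have hne : (total U m : ℝ) ≠ 0 := by exact_mod_cast hpos.ne'
  simp only [pr, ← Finset.sum_div]
  rw [div_eq_one_iff_eq hne, total]
  push_cast
  rfl

end CatalanBlock

/-! Since ∑ C_g / (2·4^g) = 1, the Catalan weights are, up to a factor depending only on m and U,
those of independent positive gaps with law `returnProb`, conditioned on m + 1 gaps having sum U +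
1. The conditioning event has probability `nthReturnProb (m + 1) (U + 1)`, which is at least c / m²
because U is of order m² (`exists_le_nthReturnProb`).

Summing over Δ turns the pairs (Δ, j) into distinct window starts a = Δ + jL. At most 2L relevant
windows stick out of {1, …, U}; after division by L they contribute at most 2. Any other counted
window has a first point, at distance x < L from a. The gap before that point exceeds x, and the
next ⌊l⌋ gaps (or all the remaining ones) sum to at least L - x. For independent gaps these events
have probabilities O(1/√(x+1)) and O(l/√(L-x)).

Conditioning costs only a constant: when l ≤ m/2, at least m/2 gaps remain, and every value of their
sum has probability O(1/m²) (`nthReturnProb_mul_sq_le`), which cancels the denominator c / m². This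
is `exists_sum_pr_gap_block_le`.

The sum over x of 1/(√(x+1)√(L-x)) is a discrete Beta(1/2, 1/2) integral, hence bounded. The m
possible first points give O(ml) in total, and division by L, which is at least m²/(2k), gives
O(lk/m). If k < 4, so that l may exceed m/2, there are only O(1) intervals altogether. -/

namespace CatalanBlock

/-! ### Return-time laws: generating function and ballot formula -/

/-- The law of half the first return time to the origin of the simple random walk on `ℤ`. -/
noncomputable def returnProb : ℕ → ℝ
  | 0 => 0
  | g + 1 => (catalan g : ℝ) / (2 * 4 ^ g)

/-- The power series `∑ g, (C_g / (2 * 4 ^ g)) X ^ g`. -/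
noncomputable def scaledCatalanSeries : PowerSeries ℝ :=
  PowerSeries.mk fun g => (catalan g : ℝ) / (2 * 4 ^ g)

/-- The generating function of `returnProb`. -/
noncomputable def returnSeries : PowerSeries ℝ := PowerSeries.mk returnProb

/-- The law of half the time of the `n`-th return to the origin. -/
noncomputable def nthReturnProb (n t : ℕ) : ℝ := PowerSeries.coeff t (returnSeries ^ n)

theorem returnProb_pos {g : ℕ} (hg : 0 < g) : 0 < returnProb g := by
  obtain ⟨d, rfl⟩ := Nat.exists_eq_succ_of_ne_zero hg.ne'
  have := catalan_pos d
  simp only [returnProb]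
  positivity

theorem returnProb_nonneg (g : ℕ) : 0 ≤ returnProb g := by
  rcases Nat.eq_zero_or_pos g with rfl | h
  · simp [returnProb]
  · exact (returnProb_pos h).le

theorem returnSeries_eq : returnSeries = PowerSeries.X * scaledCatalanSeries := by
  ext t
  cases t with
  | zero => simp [returnSeries, returnProb]
  | succ t =>
    rw [PowerSeries.coeff_succ_X_mul]
    simp [returnSeries, returnProb, scaledCatalanSeries]

/-- The Catalan equation C = 1 + XC² after rescaling X to X/4 and halving. -/
theorem two_mul_scaledCatalanSeries :
    2 * scaledCatalanSeries = 1 + PowerSeries.X * scaledCatalanSeries ^ 2 := by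
  have h2 : (2 : PowerSeries ℝ) = PowerSeries.C 2 := (map_ofNat PowerSeries.C 2).symm
  ext t
  rw [h2, PowerSeries.coeff_C_mul]
  cases t with
  | zero => simp [scaledCatalanSeries]
  | succ t =>
    rw [map_add, PowerSeries.coeff_succ_X_mul, pow_two, PowerSeries.coeff_mul,
      PowerSeries.coeff_one, if_neg (Nat.succ_ne_zero t)]
    simp only [scaledCatalanSeries, PowerSeries.coeff_mk, catalan_succ']
    push_cast
    rw [zero_add, Finset.sum_div, Finset.mul_sum]
    refine Finset.sum_congr rfl fun x hx => ?_
    rw [← Finset.HasAntidiagonal.mem_antidiagonal.1 hx, pow_succ, pow_add]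
    field_simp
    ring

/-- The series R satisfies R² = 2R - X, so its powers obey a linear recurrence; this makes the
ballot formula provable by induction. -/
theorem returnSeries_pow_add_two (n : ℕ) :
    returnSeries ^ (n + 2) = 2 * returnSeries ^ (n + 1) - PowerSeries.X * returnSeries ^ n := by
  have h : returnSeries ^ 2 = 2 * returnSeries - PowerSeries.X := by
    rw [returnSeries_eq]
    linear_combination -(PowerSeries.X : PowerSeries ℝ) * two_mul_scaledCatalanSeries
  rw [pow_add, h]
  ring

theorem nthReturnProb_one (t : ℕ) : nthReturnProb 1 t = returnProb t := by
  simp [nthReturnProb, returnSeries]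

theorem nthReturnProb_zero (t : ℕ) : nthReturnProb 0 t = if t = 0 then 1 else 0 := by
  simp [nthReturnProb, PowerSeries.coeff_one]

theorem nthReturnProb_add (a b t : ℕ) :
    nthReturnProb (a + b) t =
      ∑ x ∈ Finset.HasAntidiagonal.antidiagonal t, nthReturnProb a x.1 * nthReturnProb b x.2 := by
  simp [nthReturnProb, pow_add, PowerSeries.coeff_mul]

theorem nthReturnProb_of_lt {n t : ℕ} (h : t < n) : nthReturnProb n t = 0 := by
  rw [nthReturnProb, returnSeries_eq, mul_pow, PowerSeries.coeff_X_pow_mul', if_neg (by omega)]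

theorem nthReturnProb_add_two (n t : ℕ) :
    nthReturnProb (n + 2) (t + 1) = 2 * nthReturnProb (n + 1) (t + 1) - nthReturnProb n t := by
  have h2 : (2 : PowerSeries ℝ) = PowerSeries.C 2 := (map_ofNat PowerSeries.C 2).symm
  rw [nthReturnProb, returnSeries_pow_add_two, map_sub, h2, PowerSeries.coeff_C_mul,
    PowerSeries.coeff_succ_X_mul]
  rfl

open Nat in
/-- The ballot formula for the law of the `n`-th return time. -/
theorem nthReturnProb_eq (n d : ℕ) :
    nthReturnProb (n + 1) (n + 1 + d) =
      (n + 1) * (n + 2 * d)! / (d ! * (n + 1 + d)!) / 2 ^ (n + 1 + 2 * d) := by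
  have cat (d : ℕ) : (catalan d : ℝ) = (2 * d)! / (d ! * (d + 1)!) := by
    have h1 : ((d + 1 : ℕ) : ℝ) * catalan d = d.centralBinom := by
      exact_mod_cast succ_mul_catalan_eq_centralBinom d
    have h2 : (d.centralBinom : ℝ) = (2 * d)! / (d ! * d !) := by
      rw [Nat.centralBinom_eq_two_mul_choose, Nat.cast_choose ℝ (by omega)]
      congr 4
      omega
    have h3 : ((d + 1 : ℕ) : ℝ) ≠ 0 := by positivity
    have h4 : (d ! : ℝ) ≠ 0 := by positivity
    rw [Nat.factorial_succ]
    push_cast at *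
    rw [h2] at h1
    field_simp at h1 ⊢
    linarith
  induction n using Nat.twoStepInduction generalizing d with
  | zero =>
    rw [zero_add, nthReturnProb_one, Nat.add_comm 1 d, returnProb, cat]
    simp only [zero_add, pow_add, pow_mul]
    norm_num
  | one =>
    have h := nthReturnProb_add_two 0 (d + 1)
    rw [nthReturnProb_zero, if_neg (Nat.succ_ne_zero d), zero_add, nthReturnProb_one,
      returnProb, cat] at h
    rw [show 1 + 1 + d = d + 1 + 1 by ring, show 1 + 1 = 0 + 2 by rfl, h,
      show 2 * (d + 1) = 1 + 2 * d + 1 by ring, Nat.factorial_succ (1 + 2 * d),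
      Nat.factorial_succ d]
    have : (d ! : ℝ) ≠ 0 := by positivity
    simp only [zero_add, pow_add, pow_mul]
    push_cast
    norm_num
    field_simp
    ring
  | more n ih1 ih2 =>
    have h := nthReturnProb_add_two (n + 1) (n + 1 + (d + 1))
    rw [ih1, show n + 1 + (d + 1) + 1 = n + 1 + 1 + (d + 1) by ring, ih2] at h
    rw [show n + 2 + 1 + d = n + 1 + 1 + (d + 1) by ring, show n + 2 + 1 = n + 1 + 2 by rfl, h,
      show n + 1 + 2 * (d + 1) = n + 2 + 2 * d + 1 by ring,
      show n + 2 * (d + 1) = n + 2 + 2 * d by ring, Nat.factorial_succ (n + 2 + 2 * d),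
      Nat.factorial_succ d, show n + 1 + 1 + (d + 1) = n + 1 + (d + 1) + 1 by ring,
      Nat.factorial_succ (n + 1 + (d + 1))]
    have : (d ! : ℝ) ≠ 0 := by positivity
    have : ((n + 1 + (d + 1)) ! : ℝ) ≠ 0 := by positivity
    simp only [pow_add, pow_mul]
    push_cast
    norm_num
    field_simp
    ring

theorem nthReturnProb_nonneg (n t : ℕ) : 0 ≤ nthReturnProb n t := by
  rcases lt_or_ge t n with h | h
  · exact (nthReturnProb_of_lt h).ge
  obtain ⟨d, rfl⟩ := Nat.exists_eq_add_of_le h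
  cases n with
  | zero => rw [nthReturnProb_zero]; positivity
  | succ n => rw [nthReturnProb_eq]; positivity

open Nat in
theorem nthReturnProb_succ_time (n d : ℕ) :
    nthReturnProb (n + 1) (n + 1 + d + 1) * (4 * (d + 1) * (n + 1 + d + 1)) =
      nthReturnProb (n + 1) (n + 1 + d) * ((n + 1 + 2 * d + 1) * (n + 1 + 2 * d)) := by
  rw [add_assoc (n + 1) d 1, nthReturnProb_eq, nthReturnProb_eq,
    show n + 2 * (d + 1) = n + 2 * d + 1 + 1 by ring, Nat.factorial_succ (n + 2 * d + 1),
    Nat.factorial_succ (n + 2 * d), Nat.factorial_succ d,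
    show n + 1 + (d + 1) = n + 1 + d + 1 by ring, Nat.factorial_succ (n + 1 + d)]
  have : (d ! : ℝ) ≠ 0 := by positivity
  have : ((n + 1 + d) ! : ℝ) ≠ 0 := by positivity
  simp only [pow_add, pow_mul]
  push_cast
  norm_num
  field_simp
  ring

open Nat in
theorem nthReturnProb_succ_index (n d : ℕ) :
    nthReturnProb (n + 2) (n + 2 + d) * ((n + 1) * (n + 2 * d + 2)) =
      nthReturnProb (n + 1) (n + 2 + d) * ((n + 2) * (2 * (d + 1))) := by
  rw [show n + 2 + d = n + 1 + (d + 1) by ring, nthReturnProb_eq,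
    show n + 1 + (d + 1) = n + 1 + 1 + d by ring, nthReturnProb_eq (n + 1),
    show n + 2 * (d + 1) = n + 1 + 2 * d + 1 by ring, Nat.factorial_succ (n + 1 + 2 * d),
    Nat.factorial_succ d]
  have : (d ! : ℝ) ≠ 0 := by positivity
  have : ((n + 1 + 1 + d) ! : ℝ) ≠ 0 := by positivity
  simp only [pow_add, pow_mul]
  push_cast
  norm_num
  field_simp
  ring

/-! ### Pointwise bounds on the return-time laws -/

theorem centralBinom_sq_mul_le (d : ℕ) : (d.centralBinom : ℝ) ^ 2 * (2 * d + 1) ≤ 16 ^ d := by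
  induction d with
  | zero => simp
  | succ d ih =>
    have h : ((d : ℝ) + 1) * (d + 1).centralBinom = 2 * (2 * d + 1) * d.centralBinom := by
      exact_mod_cast Nat.succ_mul_centralBinom_succ d
    have hd : (0 : ℝ) < (d + 1) ^ 2 := by positivity
    refine le_of_mul_le_mul_left ?_ hd
    calc ((d : ℝ) + 1) ^ 2 * (((d + 1).centralBinom : ℝ) ^ 2 * (2 * ((d + 1 : ℕ) : ℝ) + 1))
        = (((d : ℝ) + 1) * (d + 1).centralBinom) ^ 2 * (2 * d + 3) := by push_cast; ring
      _ = ((d.centralBinom : ℝ) ^ 2 * (2 * d + 1)) * (4 * (2 * d + 1) * (2 * d + 3)) := by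
        rw [h]; ring
      _ ≤ 16 ^ d * (16 * (d + 1) ^ 2) :=
        mul_le_mul ih (by nlinarith) (by positivity) (by positivity)
      _ = (d + 1) ^ 2 * 16 ^ (d + 1) := by ring

theorem le_centralBinom_sq_mul (d : ℕ) : (16 : ℝ) ^ d ≤ (d.centralBinom : ℝ) ^ 2 * (4 * d + 1) := by
  induction d with
  | zero => simp
  | succ d ih =>
    have h : ((d : ℝ) + 1) * (d + 1).centralBinom = 2 * (2 * d + 1) * d.centralBinom := by
      exact_mod_cast Nat.succ_mul_centralBinom_succ d
    have hd : (0 : ℝ) < (d + 1) ^ 2 := by positivity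
    refine le_of_mul_le_mul_left ?_ hd
    have hc : (0 : ℝ) ≤ (d.centralBinom : ℝ) ^ 2 := by positivity
    calc ((d : ℝ) + 1) ^ 2 * 16 ^ (d + 1) = 16 ^ d * (16 * (d + 1) ^ 2) := by ring
      _ ≤ ((d.centralBinom : ℝ) ^ 2 * (4 * d + 1)) * (16 * (d + 1) ^ 2) := by gcongr
      _ = (d.centralBinom : ℝ) ^ 2 * ((4 * d + 1) * (16 * (d + 1) ^ 2)) := by ring
      _ ≤ (d.centralBinom : ℝ) ^ 2 * (4 * (2 * d + 1) ^ 2 * (4 * d + 5)) :=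
        mul_le_mul_of_nonneg_left (by nlinarith [(Nat.cast_nonneg d : (0 : ℝ) ≤ d)]) hc
      _ = (2 * (2 * d + 1) * (d.centralBinom : ℝ)) ^ 2 * (4 * d + 5) := by ring
      _ = (d + 1) ^ 2 * (((d + 1).centralBinom : ℝ) ^ 2 * (4 * ((d + 1 : ℕ) : ℝ) + 1)) := by
        rw [← h]; push_cast; ring

theorem returnProb_succ (d : ℕ) :
    returnProb (d + 1) = (d.centralBinom : ℝ) / (2 * (d + 1) * 4 ^ d) := by
  have h : ((d : ℝ) + 1) * catalan d = d.centralBinom := by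
    exact_mod_cast succ_mul_catalan_eq_centralBinom d
  rw [returnProb, ← h]
  have : (d : ℝ) + 1 ≠ 0 := by positivity
  field_simp

theorem returnProb_le {t : ℕ} (ht : 0 < t) : returnProb t ≤ 1 / (2 * t * √t) := by
  obtain ⟨d, rfl⟩ := Nat.exists_eq_succ_of_ne_zero ht.ne'
  have hs : (0 : ℝ) < √((d + 1 : ℕ) : ℝ) := Real.sqrt_pos.2 (by positivity)
  have key : (d.centralBinom : ℝ) * √((d + 1 : ℕ) : ℝ) ≤ 4 ^ d := by
    refine abs_le_of_sq_le_sq' ?_ (by positivity) |>.2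
    rw [mul_pow, Real.sq_sqrt (by positivity), ← pow_mul, mul_comm d 2, pow_mul]
    norm_num
    refine le_trans ?_ (centralBinom_sq_mul_le d)
    gcongr
    have : (0 : ℝ) ≤ d := by positivity
    linarith
  rw [Nat.succ_eq_add_one, returnProb_succ, div_le_div_iff₀ (by positivity) (by positivity)]
  push_cast at *
  nlinarith [mul_le_mul_of_nonneg_left key (by positivity : (0 : ℝ) ≤ 2 * (d + 1))]

theorem le_returnProb {t : ℕ} (ht : 0 < t) : 1 / (4 * t * √t) ≤ returnProb t := by
  obtain ⟨d, rfl⟩ := Nat.exists_eq_succ_of_ne_zero ht.ne'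
  have hs : (0 : ℝ) < √((d + 1 : ℕ) : ℝ) := Real.sqrt_pos.2 (by positivity)
  have key : (4 : ℝ) ^ d ≤ (d.centralBinom : ℝ) * (2 * √((d + 1 : ℕ) : ℝ)) := by
    refine abs_le_of_sq_le_sq' ?_ (by positivity) |>.2
    rw [mul_pow, mul_pow, Real.sq_sqrt (by positivity), ← pow_mul, mul_comm d 2, pow_mul]
    norm_num
    refine (le_centralBinom_sq_mul d).trans ?_
    gcongr
    linarith
  rw [Nat.succ_eq_add_one, returnProb_succ, div_le_div_iff₀ (by positivity) (by positivity)]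
  push_cast at *
  nlinarith [mul_le_mul_of_nonneg_left key (by positivity : (0 : ℝ) ≤ 2 * (d + 1))]

/-- By the ballot formula, passing from n + 1 to n + 2 returns multiplies the probability by at most
(n + 2)/(n + 1); the product telescopes. -/
theorem nthReturnProb_le_mul (n t : ℕ) : nthReturnProb (n + 1) t ≤ (n + 1) * returnProb t := by
  induction n with
  | zero => simp [nthReturnProb_one]
  | succ n ih =>
    rcases lt_or_ge t (n + 2) with h | h
    · rw [nthReturnProb_of_lt h]
      have := returnProb_nonneg t
      positivity
    obtain ⟨d, rfl⟩ := Nat.exists_eq_add_of_le h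
    have h1 := nthReturnProb_succ_index n d
    have h2 : (0 : ℝ) < (n + 1) * (n + 2 * d + 2) := by positivity
    refine le_of_mul_le_mul_right ?_ h2
    rw [h1]
    calc nthReturnProb (n + 1) (n + 2 + d) * ((n + 2) * (2 * (d + 1)))
        ≤ ((n + 1) * returnProb (n + 2 + d)) * ((n + 2) * (n + 2 * d + 2)) := by
          have := returnProb_nonneg (n + 2 + d)
          gcongr
          have : (0 : ℝ) ≤ n := by positivity
          linarith
      _ = _ := by push_cast; ring

theorem nthReturnProb_le {n t : ℕ} (ht : 0 < t) : nthReturnProb n t ≤ n / (2 * t * √t) := by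
  cases n with
  | zero => rw [nthReturnProb_zero, if_neg ht.ne']; simp
  | succ n =>
    refine (nthReturnProb_le_mul n t).trans ?_
    rw [div_eq_mul_one_div]
    push_cast
    gcongr
    exact returnProb_le ht

/-- For t ≥ n the hypothesis is exactly the condition that the ratio of consecutive terms be at
least 1, so the law increases up to about n²/6. -/
theorem nthReturnProb_le_succ_time {n t : ℕ} (h : 6 * t + 4 ≤ n ^ 2 + 3 * n) :
    nthReturnProb n t ≤ nthReturnProb n (t + 1) := by
  rcases lt_or_ge t n with h0 | h0
  · rw [nthReturnProb_of_lt h0]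
    exact nthReturnProb_nonneg _ _
  cases n with
  | zero => omega
  | succ n =>
    obtain ⟨d, rfl⟩ := Nat.exists_eq_add_of_le h0
    have h1 := nthReturnProb_succ_time n d
    have h2 : (0 : ℝ) < 4 * (d + 1) * (n + 1 + d + 1) := by positivity
    refine le_of_mul_le_mul_right ?_ h2
    rw [h1]
    refine mul_le_mul_of_nonneg_left ?_ (nthReturnProb_nonneg _ _)
    have h3 : 6 * ((n : ℝ) + 1 + d) + 4 ≤ (n + 1) ^ 2 + 3 * (n + 1) := by exact_mod_cast h
    nlinarith

/-- Beyond n²/6 the bound n/(2t√t) suffices; below it, monotonicity in t reduces to that range. -/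
theorem nthReturnProb_mul_sq_le {n : ℕ} (hn : 0 < n) (t : ℕ) :
    nthReturnProb n t * n ^ 2 ≤ 8 := by
  have large (t : ℕ) (h : n ^ 2 ≤ 6 * t) : nthReturnProb n t * n ^ 2 ≤ 8 := by
    have ht : 0 < t := by
      have : 0 < n ^ 2 := by positivity
      omega
    have hs : (0 : ℝ) < √t := Real.sqrt_pos.2 (by exact_mod_cast ht)
    have hq : √(t : ℝ) ^ 2 = t := Real.sq_sqrt (by positivity)
    -- 5/2 is a rational upper bound for √6; its cube, halved, is 125/16 ≤ 8.
    have h1 : (n : ℝ) ≤ 5 / 2 * √t := by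
      refine abs_le_of_sq_le_sq' ?_ (by positivity) |>.2
      rw [mul_pow, hq]
      have : (n : ℝ) ^ 2 ≤ 6 * t := by exact_mod_cast h
      have : (0 : ℝ) ≤ t := by positivity
      linarith
    calc nthReturnProb n t * n ^ 2 ≤ n / (2 * t * √t) * n ^ 2 := by
          gcongr; exact nthReturnProb_le ht
      _ = (n : ℝ) ^ 3 / (2 * √t ^ 3) := by
        rw [← hq]
        simp only [Real.sqrt_sq hs.le]
        field_simp
      _ ≤ (5 / 2 * √t) ^ 3 / (2 * √t ^ 3) := by gcongr
      _ = 125 / 16 := by field_simp; norm_num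
      _ ≤ 8 := by norm_num
  have step (j : ℕ) : ∀ t, n ^ 2 ≤ 6 * t + j → nthReturnProb n t * n ^ 2 ≤ 8 := by
    induction j with
    | zero => exact fun t h => large t h
    | succ j ih =>
      intro t h
      rcases le_or_gt (n ^ 2) (6 * t) with h1 | h1
      · exact large t h1
      rcases lt_or_ge t n with h0 | h0
      · rw [nthReturnProb_of_lt h0]
        norm_num
      have h2 : 2 ≤ n := by
        by_contra hlt
        have : n = 1 := by omega
        subst this
        omega
      refine le_trans ?_ (ih (t + 1) (by omega))
      gcongr
      exact nthReturnProb_le_succ_time (by omega)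
  exact step (n ^ 2) t (by omega)

/-- Converse of `nthReturnProb_le_mul`: each step falls short of the factor (n + 2)/(n + 1) by at
most 1 + N/(2D) ≤ exp(N/(2D)). -/
theorem le_nthReturnProb {N D t : ℕ} (hD : 0 < D) (ht : N + D ≤ t) (n : ℕ) (hn : n ≤ N) :
    (n + 1) * returnProb t ≤ nthReturnProb (n + 1) t * Real.exp (n * (N / (2 * D))) := by
  induction n with
  | zero => simp [nthReturnProb_one]
  | succ n ih =>
    obtain ⟨d, rfl⟩ := Nat.exists_eq_add_of_le (show n + 2 ≤ t by omega)
    have h1 := nthReturnProb_succ_index n d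
    have h2 : (0 : ℝ) < (n + 1) * (n + 2 * d + 2) := by positivity
    have hD' : (0 : ℝ) < D := by exact_mod_cast hD
    have hd : (D : ℝ) ≤ d + 1 := by exact_mod_cast (show D ≤ d + 1 by omega)
    have hnN : (n : ℝ) ≤ N := by exact_mod_cast (show n ≤ N by omega)
    have h3 : (n : ℝ) + 2 * d + 2 ≤ 2 * (d + 1) * Real.exp (N / (2 * D)) := by
      have h4 := Real.add_one_le_exp ((N : ℝ) / (2 * D))
      have h5 : (n : ℝ) ≤ 2 * (d + 1) * (N / (2 * D)) := by
        rw [mul_div_assoc', le_div_iff₀ (by positivity)]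
        nlinarith [mul_le_mul hnN hd hD'.le (by positivity)]
      nlinarith [mul_le_mul_of_nonneg_left h4 (by positivity : (0 : ℝ) ≤ 2 * (d + 1))]
    refine le_of_mul_le_mul_right ?_ h2
    have ih' := ih (by omega)
    calc ((n + 1 : ℕ) + 1 : ℝ) * returnProb (n + 2 + d) * ((n + 1) * (n + 2 * d + 2))
        = ((n + 1) * returnProb (n + 2 + d)) * ((n + 2) * (n + 2 * d + 2)) := by push_cast; ring
      _ ≤ (nthReturnProb (n + 1) (n + 2 + d) * Real.exp (n * (N / (2 * D)))) *
          ((n + 2) * (2 * (d + 1) * Real.exp (N / (2 * D)))) := by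
        have := nthReturnProb_nonneg (n + 1) (n + 2 + d)
        gcongr
      _ = (nthReturnProb (n + 1) (n + 2 + d) * ((n + 2) * (2 * (d + 1)))) *
          (Real.exp (n * (N / (2 * D))) * Real.exp (N / (2 * D))) := by ring
      _ = nthReturnProb (n + 2) (n + 2 + d) * ((n + 1) * (n + 2 * d + 2)) *
          Real.exp ((n + 1 : ℕ) * (N / (2 * D))) := by
        rw [← h1, ← Real.exp_add]
        push_cast
        ring_nf
      _ = _ := by ring

theorem exists_le_nthReturnProb {α β : ℝ} (hα : 0 < α) (hβ : 0 < β) :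
    ∃ c : ℝ, 0 < c ∧ ∀ m U : ℕ, 0 < m → m ≤ U → α * (m : ℝ) ^ 2 ≤ U → (U : ℝ) ≤ β * (m : ℝ) ^ 2 →
      c / (m : ℝ) ^ 2 ≤ nthReturnProb (m + 1) (U + 1) := by
  refine ⟨Real.exp (-(1 / α + 2 / α ^ 2)) / (8 * β * √(2 * β)), by positivity, ?_⟩
  intro m U hm hmU h1 h2
  have hm' : (0 : ℝ) < m := by exact_mod_cast hm
  set D := U + 1 - m with hD
  have hDpos : 0 < D := by omega
  have hD' : (1 : ℝ) ≤ D := by exact_mod_cast hDpos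
  have hDU : (m : ℝ) + D = U + 1 := by exact_mod_cast (show m + D = U + 1 by omega)
  have key := le_nthReturnProb hDpos (show m + D ≤ U + 1 by omega) m le_rfl
  have hexp : (m : ℝ) * (m / (2 * D)) ≤ 1 / α + 2 / α ^ 2 := by
    rw [mul_div_assoc', div_le_iff₀ (by positivity)]
    -- If U + 1 ≥ 2m then 2D ≥ U + 1 is of order m². Otherwise αm² ≤ U < 2m forces m ≤ 2/α, and D ≥
    -- 1 is enough.
    rcases le_or_gt ((2 : ℝ) * m) (U + 1) with h | h
    · have h3 : α * (m : ℝ) ^ 2 ≤ 2 * D := by linarith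
      have h4 : (m : ℝ) ^ 2 ≤ 1 / α * (2 * D) := by
        rw [one_div_mul_eq_div, le_div_iff₀ hα]
        linarith
      have h5 : 0 ≤ 2 / α ^ 2 * (2 * D) := by positivity
      nlinarith
    · have h3 : (U : ℝ) + 1 ≤ 2 * m := by
        exact h.le
      have h3' : α * m ≤ 2 := by
        refine le_of_mul_le_mul_right ?_ hm'
        nlinarith
      have h4 : (m : ℝ) * m ≤ 2 / α ^ 2 * 2 := by
        rw [div_mul_eq_mul_div, le_div_iff₀ (by positivity)]
        have : (α * m) ^ 2 ≤ 2 ^ 2 := by gcongr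
        nlinarith
      have h5 : 0 ≤ 1 / α * (2 * D) := by positivity
      have h6 : 2 / α ^ 2 * 2 ≤ 2 / α ^ 2 * (2 * D) := by gcongr; linarith
      nlinarith
  have hp := le_returnProb (Nat.succ_pos U)
  set t : ℝ := ((U + 1 : ℕ) : ℝ) with htdef
  have ht : (0 : ℝ) < t := by positivity
  have ht2 : t ≤ 2 * β * m ^ 2 := by
    have h3 : (1 : ℝ) ≤ m := by exact_mod_cast hm
    have h4 : (m : ℝ) ≤ U := by exact_mod_cast hmU
    rw [htdef]; push_cast
    linarith
  have hsqrt : √t ≤ √(2 * β) * m := by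
    refine (Real.sqrt_le_sqrt ht2).trans_eq ?_
    rw [Real.sqrt_mul (by positivity), Real.sqrt_sq hm'.le]
  have hlow : 1 / (8 * β * √(2 * β)) / (m : ℝ) ^ 2 ≤ (m + 1) * returnProb (U + 1) := by
    calc 1 / (8 * β * √(2 * β)) / (m : ℝ) ^ 2
        = m * (1 / (4 * (2 * β * m ^ 2) * (√(2 * β) * m))) := by
          have : √(2 * β) ≠ 0 := by positivity
          field_simp
          norm_num
      _ ≤ m * (1 / (4 * t * √t)) := by
        have := Real.sqrt_pos.2 ht
        gcongr
      _ ≤ (m + 1) * returnProb (U + 1) := by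
        have := returnProb_nonneg (U + 1)
        gcongr
        linarith
  have hq := nthReturnProb_nonneg (m + 1) (U + 1)
  calc Real.exp (-(1 / α + 2 / α ^ 2)) / (8 * β * √(2 * β)) / (m : ℝ) ^ 2
      = Real.exp (-(1 / α + 2 / α ^ 2)) * (1 / (8 * β * √(2 * β)) / (m : ℝ) ^ 2) := by ring
    _ ≤ Real.exp (-(1 / α + 2 / α ^ 2)) *
        (nthReturnProb (m + 1) (U + 1) * Real.exp (1 / α + 2 / α ^ 2)) := by
      gcongr
      refine hlow.trans (key.trans ?_)
      gcongr
    _ = nthReturnProb (m + 1) (U + 1) := by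
      rw [mul_comm, mul_assoc, ← Real.exp_add]
      simp

/-! ### Tail sums and a discrete Beta integral -/

theorem one_div_mul_sqrt_le {t : ℕ} (ht : 0 < t) :
    1 / ((t : ℝ) * √t) ≤ 4 * (1 / √t - 1 / √((t + 1 : ℕ) : ℝ)) := by
  have ht' : (1 : ℝ) ≤ t := by exact_mod_cast ht
  have ha : 0 < √(t : ℝ) := Real.sqrt_pos.2 (by positivity)
  have hb : 0 < √((t + 1 : ℕ) : ℝ) := Real.sqrt_pos.2 (by positivity)
  have ha2 : √(t : ℝ) ^ 2 = t := Real.sq_sqrt (by positivity)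
  have hb2 : √((t + 1 : ℕ) : ℝ) ^ 2 = t + 1 := by
    rw [Real.sq_sqrt (by positivity)]; push_cast; ring
  generalize √(t : ℝ) = a at *
  generalize √((t + 1 : ℕ) : ℝ) = b at *
  have hab : b ≤ 3 / 2 * a := by
    refine abs_le_of_sq_le_sq' ?_ (by positivity) |>.2
    nlinarith
  rw [← ha2, div_sub_div _ _ ha.ne' hb.ne', mul_div_assoc', div_le_div_iff₀ (by positivity)
    (by positivity)]
  have h1 : (b - a) * (b + a) = 1 := by nlinarith
  have h2 : a * b * (b + a) ≤ 4 * a ^ 3 := by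
    have : b * (b + a) ≤ 3 / 2 * a * (3 / 2 * a + a) := by gcongr
    nlinarith [mul_le_mul_of_nonneg_left this ha.le, pow_pos ha 3]
  have h3 : 0 < b + a := by positivity
  refine le_of_mul_le_mul_right ?_ h3
  calc 1 * (a * b) * (b + a) = a * b * (b + a) := by ring
    _ ≤ 4 * a ^ 3 := h2
    _ = 4 * ((b - a) * (b + a)) * a ^ 3 := by rw [h1]; ring
    _ = _ := by ring

theorem sum_nthReturnProb_le (n : ℕ) {y : ℕ} (hy : 0 < y) (M : ℕ) :
    ∑ t ∈ Finset.Ico y M, nthReturnProb n t ≤ 2 * n / √y := by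
  rcases lt_or_ge M y with h | h
  · rw [Finset.Ico_eq_empty (by omega), Finset.sum_empty]
    positivity
  suffices H : ∑ t ∈ Finset.Ico y M, nthReturnProb n t ≤ 2 * n * (1 / √y - 1 / √M) by
    refine H.trans ?_
    rw [mul_sub, mul_one_div, sub_le_self_iff]
    positivity
  induction M, h using Nat.le_induction with
  | base => simp
  | succ M hM ih =>
    rw [Finset.sum_Ico_succ_top hM]
    have h1 := nthReturnProb_le (n := n) (hy.trans_le hM)
    have h2 := mul_le_mul_of_nonneg_left (one_div_mul_sqrt_le (hy.trans_le hM))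
      (by positivity : (0 : ℝ) ≤ n / 2)
    have h3 : (n : ℝ) / (2 * M * √M) = n / 2 * (1 / (M * √M)) := by
      rw [mul_one_div, div_div, mul_assoc]
    linarith

theorem sum_one_div_sqrt_le (L : ℕ) : ∑ x ∈ Finset.range L, 1 / √((x : ℝ) + 1) ≤ 2 * √L := by
  induction L with
  | zero => simp
  | succ L ih =>
    rw [Finset.sum_range_succ]
    have hb : 0 < √((L : ℝ) + 1) := Real.sqrt_pos.2 (by positivity)
    have hab : √(L : ℝ) ≤ √((L : ℝ) + 1) := Real.sqrt_le_sqrt (by linarith)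
    have ha0 : 0 ≤ √(L : ℝ) := Real.sqrt_nonneg _
    have ha2 : √(L : ℝ) ^ 2 = L := Real.sq_sqrt (by positivity)
    have hb2 : √((L : ℝ) + 1) ^ 2 = L + 1 := Real.sq_sqrt (by positivity)
    have : 1 / √((L : ℝ) + 1) ≤ 2 * (√((L : ℝ) + 1) - √L) := by
      rw [div_le_iff₀ hb]
      nlinarith
    push_cast
    linarith

theorem sum_one_div_sqrt_mul_sqrt_le (L : ℕ) :
    ∑ x ∈ Finset.range L, 1 / √((x : ℝ) + 1) * (1 / √((L - x : ℕ) : ℝ)) ≤ 6 := by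
  rcases Nat.eq_zero_or_pos L with rfl | hL
  · simp
  have hsL : 0 < √(L : ℝ) := Real.sqrt_pos.2 (by exact_mod_cast hL)
  have bound {a b : ℝ} (ha : 1 ≤ a) (hb : 1 ≤ b) (hab : (L : ℝ) ≤ a + b) :
      1 / √a * (1 / √b) ≤ 3 / 2 / √L * (1 / √a + 1 / √b) := by
    -- The larger of a and b is at least L/2, so the reciprocal of its root is at most √2/√L; 3/2
    -- bounds √2.
    have main {a b : ℝ} (ha : 1 ≤ a) (hb : 1 ≤ b) (h : (L : ℝ) ≤ 2 * b) :
        1 / √a * (1 / √b) ≤ 3 / 2 / √L * (1 / √a + 1 / √b) := by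
      have hsb : 0 < √b := Real.sqrt_pos.2 (by linarith)
      have hsa : 0 < √a := Real.sqrt_pos.2 (by linarith)
      have h1 : 1 / √b ≤ 3 / 2 / √L := by
        rw [div_le_div_iff₀ hsb hsL]
        refine abs_le_of_sq_le_sq' ?_ (by positivity) |>.2
        rw [mul_pow, mul_pow, Real.sq_sqrt (by positivity), Real.sq_sqrt (by positivity)]
        linarith
      calc 1 / √a * (1 / √b) ≤ 1 / √a * (3 / 2 / √L) := by gcongr
        _ ≤ (1 / √a + 1 / √b) * (3 / 2 / √L) := by
          gcongr
          rw [le_add_iff_nonneg_right]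
          positivity
        _ = _ := mul_comm _ _
    rcases le_total (L : ℝ) (2 * b) with h | h
    · exact main ha hb h
    · rw [mul_comm (1 / √a), add_comm (1 / √a)]
      exact main hb ha (by linarith)
  calc ∑ x ∈ Finset.range L, 1 / √((x : ℝ) + 1) * (1 / √((L - x : ℕ) : ℝ))
      ≤ ∑ x ∈ Finset.range L,
          3 / 2 / √L * (1 / √((x : ℝ) + 1) + 1 / √((L - x : ℕ) : ℝ)) := by
        refine Finset.sum_le_sum fun x hx => ?_
        have hx' := Finset.mem_range.1 hx
        refine bound (by linarith [(Nat.cast_nonneg x : (0 : ℝ) ≤ x)]) ?_ ?_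
        · exact_mod_cast (show 1 ≤ L - x by omega)
        · exact_mod_cast (show L ≤ x + 1 + (L - x) by omega)
    _ = 3 / 2 / √L * (∑ x ∈ Finset.range L, 1 / √((x : ℝ) + 1) +
          ∑ x ∈ Finset.range L, 1 / √((x : ℝ) + 1)) := by
        rw [← Finset.mul_sum, Finset.sum_add_distrib]
        congr 2
        rw [← Finset.sum_range_reflect]
        refine Finset.sum_congr rfl fun x hx => ?_
        have hx' := Finset.mem_range.1 hx
        rw [show L - (L - 1 - x) = x + 1 by omega]
        push_cast
        rfl
    _ ≤ 3 / 2 / √L * (2 * √L + 2 * √L) := by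
        gcongr <;> exact sum_one_div_sqrt_le L
    _ = 6 := by field_simp; norm_num

/-! ### Independent gaps as sums over compositions -/

theorem sum_piAntidiag_union {ι : Type*} [DecidableEq ι] {s t : Finset ι} (hst : Disjoint s t)
    (N : ℕ) (F G : (ι → ℕ) → ℝ) (hF : ∀ f g, (∀ i ∈ s, f i = g i) → F f = F g)
    (hG : ∀ f g, (∀ i ∈ t, f i = g i) → G f = G g) :
    ∑ g ∈ Finset.piAntidiag (s ∪ t) N, F g * G g =
      ∑ x ∈ Finset.HasAntidiagonal.antidiagonal N,
        (∑ f ∈ Finset.piAntidiag s x.1, F f) * ∑ h ∈ Finset.piAntidiag t x.2, G h := by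
  simp_rw [Finset.sum_mul_sum, ← Finset.sum_product']
  rw [Finset.sum_sigma']
  -- A composition supported on the union corresponds to its two restrictions, recombined by
  -- addition.
  refine Finset.sum_bij'
    (fun g _ => ⟨(∑ i ∈ s, g i, ∑ i ∈ t, g i),
      (fun i => if i ∈ s then g i else 0, fun i => if i ∈ t then g i else 0)⟩)
    (fun z _ => z.2.1 + z.2.2) ?_ ?_ ?_ ?_ ?_
  · intro g hg
    rw [Finset.mem_piAntidiag, Finset.sum_union hst] at hg
    simp only [Finset.mem_sigma, Finset.HasAntidiagonal.mem_antidiagonal, Finset.mem_product,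
      Finset.mem_piAntidiag, hg.1, true_and]
    refine ⟨⟨Finset.sum_congr rfl fun i hi => if_pos hi, fun i hi => ?_⟩,
      ⟨Finset.sum_congr rfl fun i hi => if_pos hi, fun i hi => ?_⟩⟩ <;>
    · by_contra h
      simp [h] at hi
  · rintro ⟨⟨a, b⟩, f, h⟩ hz
    simp only [Finset.mem_sigma, Finset.HasAntidiagonal.mem_antidiagonal, Finset.mem_product,
      Finset.mem_piAntidiag] at hz
    obtain ⟨hab, ⟨hf, hfs⟩, hh, hht⟩ := hz
    have h1 : ∑ i ∈ s, h i = 0 := Finset.sum_eq_zero fun i hi => by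
      by_contra hne
      exact Finset.disjoint_left.1 hst hi (hht i hne)
    have h2 : ∑ i ∈ t, f i = 0 := Finset.sum_eq_zero fun i hi => by
      by_contra hne
      exact Finset.disjoint_left.1 hst (hfs i hne) hi
    rw [Finset.mem_piAntidiag, Finset.sum_union hst]
    simp only [Pi.add_apply, Finset.sum_add_distrib, h1, h2, hf, hh]
    refine ⟨by omega, fun i hi => Finset.mem_union.2 ?_⟩
    rcases Nat.eq_zero_or_pos (f i) with h0 | h0
    · exact Or.inr (hht i (by omega))
    · exact Or.inl (hfs i (by omega))
  · intro g hg
    rw [Finset.mem_piAntidiag] at hg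
    funext i
    simp only [Pi.add_apply]
    by_cases h1 : i ∈ s
    · have h2 : i ∉ t := Finset.disjoint_left.1 hst h1
      simp [h1, h2]
    · by_cases h2 : i ∈ t
      · simp [h1, h2]
      · have : g i = 0 := by
          by_contra h
          exact (Finset.mem_union.1 (hg.2 i h)).elim h1 h2
        simp [h1, h2, this]
  · rintro ⟨⟨a, b⟩, f, h⟩ hz
    simp only [Finset.mem_sigma, Finset.HasAntidiagonal.mem_antidiagonal, Finset.mem_product,
      Finset.mem_piAntidiag] at hz
    obtain ⟨hab, ⟨hf, hfs⟩, hh, hht⟩ := hz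
    have h1 : ∀ i ∈ s, h i = 0 := fun i hi => by
      by_contra hne
      exact Finset.disjoint_left.1 hst hi (hht i hne)
    have h2 : ∀ i ∈ t, f i = 0 := fun i hi => by
      by_contra hne
      exact Finset.disjoint_left.1 hst (hfs i hne) hi
    have e1 : ∑ i ∈ s, (f + h) i = a := by
      rw [← hf]
      exact Finset.sum_congr rfl fun i hi => by simp [h1 i hi]
    have e2 : ∑ i ∈ t, (f + h) i = b := by
      rw [← hh]
      exact Finset.sum_congr rfl fun i hi => by simp [h2 i hi]
    have e3 : (fun i => if i ∈ s then (f + h) i else 0) = f := by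
      funext i
      by_cases hi : i ∈ s
      · simp [hi, h1 i hi]
      · rw [if_neg hi]
        by_contra hne
        exact hi (hfs i (Ne.symm hne))
    have e4 : (fun i => if i ∈ t then (f + h) i else 0) = h := by
      funext i
      by_cases hi : i ∈ t
      · simp [hi, h2 i hi]
      · rw [if_neg hi]
        by_contra hne
        exact hi (hht i (Ne.symm hne))
    simp only [e1, e2, e3, e4]
  · intro g _
    exact congrArg₂ _ (hF _ _ fun i hi => by simp [hi]) (hG _ _ fun i hi => by simp [hi])

theorem sum_piAntidiag_singleton {ι : Type*} [DecidableEq ι] (i : ι) (u : ℕ) (F : ℕ → ℝ) :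
    ∑ f ∈ Finset.piAntidiag {i} u, F (f i) = F u := by
  have h : Finset.piAntidiag {i} u = {Pi.single i u} := by
    ext f
    simp only [Finset.mem_piAntidiag, Finset.sum_singleton, Finset.mem_singleton]
    constructor
    · rintro ⟨h1, h2⟩
      funext j
      by_cases hj : j = i
      · subst hj; simp [h1]
      · rw [Pi.single_eq_of_ne hj]
        by_contra h
        exact hj (h2 j h)
    · rintro rfl
      refine ⟨by simp, fun j hj => ?_⟩
      by_contra h
      exact hj (Pi.single_eq_of_ne h _)
  rw [h, Finset.sum_singleton, Pi.single_eq_same]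

theorem sum_prod_returnProb {ι : Type*} [DecidableEq ι] (s : Finset ι) (N : ℕ) :
    ∑ f ∈ Finset.piAntidiag s N, ∏ i ∈ s, returnProb (f i) = nthReturnProb s.card N := by
  induction s using Finset.induction_on generalizing N with
  | empty =>
    rw [Finset.piAntidiag_empty, Finset.card_empty, nthReturnProb_zero]
    split_ifs <;> simp
  | insert i s hi ih =>
    simp_rw [Finset.prod_insert hi]
    rw [Finset.card_insert_of_notMem hi, Finset.insert_eq,
      sum_piAntidiag_union (Finset.disjoint_singleton_left.2 hi) N
        (fun f => returnProb (f i)) (fun f => ∏ j ∈ s, returnProb (f j))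
        (fun f g h => by simp [h]) (fun f g h => Finset.prod_congr rfl fun j hj => by rw [h j hj]),
      add_comm, nthReturnProb_add]
    refine Finset.sum_congr rfl fun x _ => ?_
    rw [sum_piAntidiag_singleton i x.1 returnProb, ih, nthReturnProb_one]

/-- The gap i, the block J and the remaining gaps are convolved. Bounding the remaining factor by Q
uniformly frees the first two from the constraint on the total, leaving a product of tails. -/
theorem sum_piAntidiag_gap_block_le {ι : Type*} [DecidableEq ι] [Fintype ι] {i : ι}
    {J : Finset ι} (hi : i ∉ J) {Q : ℝ} (N x y : ℕ) (hy : 0 < y)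
    (hQ : ∀ z, nthReturnProb (Finset.univ \ insert i J).card z ≤ Q) :
    ∑ g ∈ Finset.piAntidiag (Finset.univ : Finset ι) N,
        (∏ j, returnProb (g j)) * (if x < g i ∧ y ≤ ∑ j ∈ J, g j then 1 else 0) ≤
      (2 / √((x : ℝ) + 1)) * (2 * J.card / √(y : ℝ)) * Q := by
  set R := Finset.univ \ insert i J with hR
  have hQ0 : 0 ≤ Q := (nthReturnProb_nonneg _ 0).trans (hQ 0)
  have hJR : Disjoint J R :=
    Finset.disjoint_sdiff.mono_left (Finset.subset_insert i J)
  have hiR : i ∉ R := by simp [hR]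
  have hiJR : Disjoint {i} (J ∪ R) := by simp [hi, hiR]
  have huniv : (Finset.univ : Finset ι) = {i} ∪ (J ∪ R) := by
    rw [← Finset.union_assoc, ← Finset.insert_eq, hR, Finset.union_sdiff_of_subset
      (Finset.subset_univ _)]
  have hprod (g : ι → ℕ) : (∏ j, returnProb (g j)) *
        (if x < g i ∧ y ≤ ∑ j ∈ J, g j then (1 : ℝ) else 0) =
      (returnProb (g i) * if x < g i then 1 else 0) *
        (((∏ j ∈ J, returnProb (g j)) * if y ≤ ∑ j ∈ J, g j then 1 else 0) *
          ∏ j ∈ R, returnProb (g j)) := by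
    rw [huniv, Finset.prod_union hiJR, Finset.prod_union hJR, Finset.prod_singleton, ite_and]
    split_ifs <;> ring
  have hcongr (T : Finset ι) (f g : ι → ℕ) (h : ∀ i ∈ T, f i = g i) :
      ∏ j ∈ T, returnProb (f j) = ∏ j ∈ T, returnProb (g j) :=
    Finset.prod_congr rfl fun j hj => by rw [h j hj]
  have hcongrJ (f g : ι → ℕ) (h : ∀ i ∈ J, f i = g i) :
      ((∏ j ∈ J, returnProb (f j)) * if y ≤ ∑ j ∈ J, f j then (1 : ℝ) else 0) =
        (∏ j ∈ J, returnProb (g j)) * if y ≤ ∑ j ∈ J, g j then (1 : ℝ) else 0 := by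
    rw [hcongr J f g h, Finset.sum_congr rfl h]
  simp_rw [hprod]
  rw [huniv, sum_piAntidiag_union hiJR N
    (fun g => returnProb (g i) * if x < g i then 1 else 0)
    (fun g => ((∏ j ∈ J, returnProb (g j)) * if y ≤ ∑ j ∈ J, g j then 1 else 0) *
          ∏ j ∈ R, returnProb (g j))
    (fun f g h => congrArg (fun u => returnProb u * if x < u then (1 : ℝ) else 0)
      (h i (Finset.mem_singleton_self i)))
    (fun f g h => by
      rw [hcongrJ f g fun i hi => h i (Finset.mem_union_left _ hi),
        hcongr R f g fun i hi => h i (Finset.mem_union_right _ hi)])]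
  have hJ (v : ℕ) : ∑ f ∈ Finset.piAntidiag J v,
      ((∏ j ∈ J, returnProb (f j)) * if y ≤ ∑ j ∈ J, f j then (1 : ℝ) else 0) =
        nthReturnProb J.card v * if y ≤ v then 1 else 0 := by
    rw [← sum_prod_returnProb, Finset.sum_mul]
    refine Finset.sum_congr rfl fun f hf => ?_
    rw [(Finset.mem_piAntidiag.1 hf).1]
  have htail (n w a : ℕ) (hw : w ≤ N) : ∑ z ∈ Finset.HasAntidiagonal.antidiagonal w,
      nthReturnProb n z.1 * (if a ≤ z.1 then (1 : ℝ) else 0) ≤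
        ∑ t ∈ Finset.Ico a (N + 1), nthReturnProb n t := by
    rw [Finset.Nat.sum_antidiagonal_eq_sum_range_succ_mk]
    simp only [mul_ite, mul_one, mul_zero]
    rw [← Finset.sum_filter]
    refine Finset.sum_le_sum_of_subset_of_nonneg ?_ fun _ _ _ => nthReturnProb_nonneg _ _
    intro t ht
    simp only [Finset.mem_filter, Finset.mem_range] at ht
    exact Finset.mem_Ico.2 ⟨ht.2, by omega⟩
  have hinner (w : ℕ) (hw : w ≤ N) : ∑ h ∈ Finset.piAntidiag (J ∪ R) w,
      (((∏ j ∈ J, returnProb (h j)) * if y ≤ ∑ j ∈ J, h j then (1 : ℝ) else 0) *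
          ∏ j ∈ R, returnProb (h j)) ≤ 2 * J.card / √(y : ℝ) * Q := by
    rw [sum_piAntidiag_union hJR w
      (fun h => (∏ j ∈ J, returnProb (h j)) * if y ≤ ∑ j ∈ J, h j then (1 : ℝ) else 0)
      (fun h => ∏ j ∈ R, returnProb (h j)) hcongrJ (hcongr R)]
    simp only [hJ, sum_prod_returnProb]
    calc _ ≤ ∑ z ∈ Finset.HasAntidiagonal.antidiagonal w,
          nthReturnProb J.card z.1 * (if y ≤ z.1 then (1 : ℝ) else 0) * Q := by
          refine Finset.sum_le_sum fun z _ => mul_le_mul_of_nonneg_left (hQ z.2) ?_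
          have := nthReturnProb_nonneg J.card z.1
          positivity
      _ ≤ _ := by
        rw [← Finset.sum_mul]
        exact mul_le_mul_of_nonneg_right
          ((htail _ w y hw).trans (sum_nthReturnProb_le _ hy _)) hQ0
  calc _ ≤ ∑ z ∈ Finset.HasAntidiagonal.antidiagonal N,
        nthReturnProb 1 z.1 * (if x + 1 ≤ z.1 then (1 : ℝ) else 0) *
          (2 * J.card / √(y : ℝ) * Q) := by
        refine Finset.sum_le_sum fun z hz => ?_
        rw [sum_piAntidiag_singleton i z.1 fun u => returnProb u * if x < u then 1 else 0,
          nthReturnProb_one]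
        have := returnProb_nonneg z.1
        have hz' := Finset.HasAntidiagonal.mem_antidiagonal.1 hz
        exact mul_le_mul_of_nonneg_left (hinner z.2 (by omega)) (by positivity)
    _ ≤ _ := by
      rw [← Finset.sum_mul, mul_assoc]
      refine mul_le_mul_of_nonneg_right ?_
        (mul_nonneg (div_nonneg (mul_nonneg zero_le_two (Nat.cast_nonneg _)) (Real.sqrt_nonneg _)) hQ0)
      have h := sum_nthReturnProb_le 1 x.succ_pos (N + 1)
      rw [Nat.cast_one, mul_one, Nat.succ_eq_add_one, Nat.cast_add, Nat.cast_one] at h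
      exact (htail 1 N (x + 1) le_rfl).trans h

/-! ### From point sets to conditioned gaps -/

/-- The gaps `s_{j+1} - s_j`. -/
def gaps {U m : ℕ} (s : Fin (m + 2) → Fin (U + 2)) (j : Fin (m + 1)) : ℕ :=
  (s j.succ : ℕ) - (s j.castSucc : ℕ)

theorem mem_configs {U m : ℕ} {s : Fin (m + 2) → Fin (U + 2)} :
    s ∈ configs U m ↔
      StrictMono s ∧ s 0 = 0 ∧ s (Fin.last (m + 1)) = Fin.last (U + 1) := by
  simp [configs]

theorem add_gaps {U m : ℕ} {s : Fin (m + 2) → Fin (U + 2)} (hs : StrictMono s)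
    (j : Fin (m + 1)) : (s j.castSucc : ℕ) + gaps s j = s j.succ := by
  have h : (s j.castSucc : ℕ) < s j.succ := hs j.castSucc_lt_succ
  rw [gaps]
  omega

theorem gaps_pos {U m : ℕ} {s : Fin (m + 2) → Fin (U + 2)} (hs : StrictMono s)
    (j : Fin (m + 1)) : 0 < gaps s j := by
  have h : (s j.castSucc : ℕ) < s j.succ := hs j.castSucc_lt_succ
  rw [gaps]
  omega

theorem filter_Ico_succ {m : ℕ} {i r : ℕ} (hir : i ≤ r) (hr : r < m + 1) :
    (Finset.univ.filter fun j : Fin (m + 1) => i ≤ (j : ℕ) ∧ (j : ℕ) < r + 1) =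
      insert ⟨r, hr⟩ (Finset.univ.filter fun j : Fin (m + 1) => i ≤ (j : ℕ) ∧ (j : ℕ) < r) := by
  ext j
  simp only [Finset.mem_filter, Finset.mem_univ, true_and, Finset.mem_insert, Fin.ext_iff]
  omega

theorem add_sum_gaps {U m : ℕ} {s : Fin (m + 2) → Fin (U + 2)} (hs : StrictMono s) {i r : ℕ}
    (hir : i ≤ r) (hr : r < m + 2) :
    (s ⟨i, by omega⟩ : ℕ) +
      ∑ j ∈ Finset.univ.filter (fun j : Fin (m + 1) => i ≤ (j : ℕ) ∧ (j : ℕ) < r), gaps s j =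
        s ⟨r, hr⟩ := by
  induction r, hir using Nat.le_induction with
  | base =>
    rw [Finset.filter_false_of_mem (fun j _ => by omega), Finset.sum_empty, add_zero]
  | succ r hir ih =>
    rw [filter_Ico_succ hir (by omega), Finset.sum_insert (by simp)]
    have h1 := ih (by omega)
    have h2 : (s ⟨r, by omega⟩ : ℕ) + gaps s ⟨r, by omega⟩ = s ⟨r + 1, hr⟩ :=
      add_gaps hs ⟨r, by omega⟩
    omega

theorem card_filter_Ico {m i r : ℕ} (hr : r ≤ m + 1) :
    (Finset.univ.filter fun j : Fin (m + 1) => i ≤ (j : ℕ) ∧ (j : ℕ) < r).card = r - i := by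
  rw [← Nat.card_Ico, ← Finset.card_map Fin.valEmbedding]
  congr 1
  ext j
  simp only [Finset.mem_map, Finset.mem_filter, Finset.mem_univ, true_and, Finset.mem_Ico,
    Fin.valEmbedding_apply]
  constructor
  · rintro ⟨j, h, rfl⟩
    exact h
  · intro h
    exact ⟨⟨j, by omega⟩, h, rfl⟩

theorem sum_gaps {U m : ℕ} {s : Fin (m + 2) → Fin (U + 2)} (hs : s ∈ configs U m) :
    ∑ j, gaps s j = U + 1 := by
  obtain ⟨h1, h2, h3⟩ := mem_configs.1 hs
  have h := add_sum_gaps h1 (Nat.zero_le (m + 1)) (Nat.lt_succ_self _)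
  rw [Finset.filter_true_of_mem (fun j _ => by omega)] at h
  have h2' : (s ⟨0, by omega⟩ : ℕ) = 0 := congrArg Fin.val h2
  have h3' : (s ⟨m + 1, by omega⟩ : ℕ) = U + 1 := congrArg Fin.val h3
  omega

theorem gaps_injOn (U m : ℕ) : Set.InjOn gaps (configs U m : Set (Fin (m + 2) → Fin (U + 2))) := by
  intro s hs s' hs' h
  obtain ⟨h1, h2, -⟩ := mem_configs.1 hs
  obtain ⟨h1', h2', -⟩ := mem_configs.1 hs'
  funext j
  induction j using Fin.induction with
  | zero => rw [h2, h2']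
  | succ j ih =>
    ext
    rw [← add_gaps h1, ← add_gaps h1', ih, h]

theorem exists_gaps_eq {U m : ℕ} {g : Fin (m + 1) → ℕ} (hg : ∑ j, g j = U + 1)
    (hpos : ∀ j, 0 < g j) : ∃ s ∈ configs U m, gaps s = g := by
  set S : ℕ → ℕ := fun r =>
    ∑ j ∈ Finset.univ.filter (fun j : Fin (m + 1) => 0 ≤ (j : ℕ) ∧ (j : ℕ) < r), g j with hS
  have hle (r : ℕ) : S r < U + 2 := by
    have : S r ≤ U + 1 := by
      rw [← hg]
      exact Finset.sum_le_sum_of_subset (Finset.filter_subset _ _)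
    omega
  have hsucc (j : Fin (m + 1)) : S (j + 1) = S j + g j := by
    simp only [hS]
    rw [filter_Ico_succ (Nat.zero_le _) j.2, Finset.sum_insert (by simp), add_comm]
  refine ⟨fun j => ⟨S j, hle j⟩, mem_configs.2 ⟨?_, ?_, ?_⟩, ?_⟩
  · refine Fin.strictMono_iff_lt_succ.2 fun j => ?_
    have := hpos j
    have := hsucc j
    rw [Fin.mk_lt_mk]
    simp only [Fin.val_castSucc, Fin.val_succ]
    omega
  · ext
    simp [hS]
  · ext
    simp only [Fin.val_last]
    rw [← hg, hS]
    simp only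
    rw [Finset.filter_true_of_mem (fun j _ => by omega)]
  · funext j
    have := hsucc j
    simp only [gaps, Fin.val_castSucc, Fin.val_succ]
    omega

/-- Vanishing at zero gaps lets the sum run over all compositions, not only those with positive
parts. -/
theorem sum_configs_eq {U m : ℕ} (Φ : (Fin (m + 1) → ℕ) → ℝ) (hΦ : ∀ g j, g j = 0 → Φ g = 0) :
    ∑ s ∈ configs U m, Φ (gaps s) = ∑ g ∈ Finset.piAntidiag Finset.univ (U + 1), Φ g := by
  refine Finset.sum_of_injOn gaps (gaps_injOn U m) ?_ ?_ fun _ _ => rfl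
  · intro s hs
    simp [sum_gaps hs]
  · intro g hg hne
    by_contra h
    obtain ⟨s, hs, rfl⟩ := exists_gaps_eq (Finset.mem_piAntidiag.1 hg).1
      fun j => Nat.pos_of_ne_zero fun h0 => h (hΦ g j h0)
    exact hne ⟨s, hs, rfl⟩

theorem weight_eq {U m : ℕ} {s : Fin (m + 2) → Fin (U + 2)} (hs : s ∈ configs U m) :
    (weight s : ℝ) = (∏ j, returnProb (gaps s j)) * (2 ^ (m + 1) / 4 ^ (U + 1))⁻¹ := by
  have h (g : ℕ) (hg : 0 < g) : (catalan (g - 1) : ℝ) = returnProb g * (4 ^ g / 2) := by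
    obtain ⟨d, rfl⟩ := Nat.exists_eq_succ_of_ne_zero hg.ne'
    rw [Nat.succ_eq_add_one, Nat.add_sub_cancel, returnProb]
    field_simp
    ring
  have h1 := (mem_configs.1 hs).1
  rw [weight, Nat.cast_prod]
  change ∏ j, (catalan (gaps s j - 1) : ℝ) = _
  rw [Finset.prod_congr rfl fun j _ => h _ (gaps_pos h1 j),
    Finset.prod_mul_distrib, Finset.prod_div_distrib, Finset.prod_pow_eq_pow_sum, sum_gaps hs,
    Finset.prod_const, Finset.card_univ, Fintype.card_fin, inv_div]

theorem sum_pr_mul_eq {U m : ℕ} (φ : (Fin (m + 1) → ℕ) → ℝ) :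
    ∑ s ∈ configs U m, pr s * φ (gaps s) =
      (∑ g ∈ Finset.piAntidiag Finset.univ (U + 1), (∏ j, returnProb (g j)) * φ g) /
        nthReturnProb (m + 1) (U + 1) := by
  have hzero (ψ : (Fin (m + 1) → ℕ) → ℝ) (g : Fin (m + 1) → ℕ) (j : Fin (m + 1)) (h : g j = 0) :
      (∏ j, returnProb (g j)) * ψ g = 0 := by
    rw [Finset.prod_eq_zero (Finset.mem_univ j) (by rw [h, returnProb]), zero_mul]
  have hc : ((2 : ℝ) ^ (m + 1) / 4 ^ (U + 1))⁻¹ ≠ 0 := by positivity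
  have htotal : (total U m : ℝ) =
      nthReturnProb (m + 1) (U + 1) * (2 ^ (m + 1) / 4 ^ (U + 1))⁻¹ := by
    rw [total, Nat.cast_sum, Finset.sum_congr rfl fun s hs => weight_eq hs, ← Finset.sum_mul]
    have h1 := sum_configs_eq (U := U) (m := m) (fun g => (∏ j, returnProb (g j)) * 1)
      (hzero fun _ => 1)
    simp only [mul_one] at h1
    have h2 := sum_prod_returnProb (Finset.univ : Finset (Fin (m + 1))) (U + 1)
    rw [Finset.card_univ, Fintype.card_fin] at h2
    rw [h1, h2]
  rw [← sum_configs_eq _ (hzero φ), Finset.sum_div]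
  refine Finset.sum_congr rfl fun s hs => ?_
  rw [pr, htotal, weight_eq hs, mul_div_mul_right _ _ hc, div_mul_eq_mul_div]

theorem pr_nonneg {U m : ℕ} (s : Fin (m + 2) → Fin (U + 2)) : 0 ≤ pr s := by
  rw [pr]
  positivity

/-- For `U` of order `m ^ 2`, the joint upper tail of one gap and of the sum of at most `m / 2`
other gaps is at most a constant times what it is for independent gaps. -/
theorem exists_sum_pr_gap_block_le {α β : ℝ} (hα : 0 < α) (hβ : 0 < β) :
    ∃ K : ℝ, 0 < K ∧ ∀ (m U : ℕ), 0 < m → m ≤ U → α * (m : ℝ) ^ 2 ≤ U →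
      (U : ℝ) ≤ β * (m : ℝ) ^ 2 → ∀ (i : Fin (m + 1)) (J : Finset (Fin (m + 1))), i ∉ J →
      2 * J.card ≤ m → ∀ x y : ℕ, 0 < y →
      ∑ s ∈ configs U m, pr s * (if x < gaps s i ∧ y ≤ ∑ j ∈ J, gaps s j then 1 else 0) ≤
        K * J.card * (1 / √((x : ℝ) + 1) * (1 / √(y : ℝ))) := by
  obtain ⟨c, hc, hlow⟩ := exists_le_nthReturnProb hα hβ
  -- The 4 comes from the factors 2 of the two tails; 32 = 4·8 because the m - |J| ≥ m/2 remaining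
  -- gaps have point probabilities at most 8/(m/2)².
  refine ⟨4 * (32 / c), by positivity, ?_⟩
  intro m U hm hmU h1 h2 i J hi hJ x y hy
  have hm' : (0 : ℝ) < m := by exact_mod_cast hm
  have hq := hlow m U hm hmU h1 h2
  have hqpos : 0 < nthReturnProb (m + 1) (U + 1) := lt_of_lt_of_le (by positivity) hq
  rw [sum_pr_mul_eq fun g => if x < g i ∧ y ≤ ∑ j ∈ J, g j then 1 else 0, div_le_iff₀ hqpos]
  have hcard : (Finset.univ \ insert i J).card = m - J.card := by
    rw [Finset.card_sdiff_of_subset (Finset.subset_univ _), Finset.card_insert_of_notMem hi,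
      Finset.card_univ, Fintype.card_fin]
    omega
  refine (sum_piAntidiag_gap_block_le hi (Q := 32 / m ^ 2) (U + 1) x y hy fun z => ?_).trans ?_
  · rw [hcard, le_div_iff₀ (by positivity)]
    have h3 := nthReturnProb_mul_sq_le (n := m - J.card) (by omega) z
    have h4 : (m : ℝ) ≤ 2 * (m - J.card : ℕ) := by exact_mod_cast (by omega)
    have h5 := nthReturnProb_nonneg (m - J.card) z
    calc nthReturnProb (m - J.card) z * (m : ℝ) ^ 2
        ≤ nthReturnProb (m - J.card) z * (2 * (m - J.card : ℕ)) ^ 2 := by gcongr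
      _ = 4 * (nthReturnProb (m - J.card) z * ((m - J.card : ℕ) : ℝ) ^ 2) := by ring
      _ ≤ 32 := by linarith
  · have hA : 0 ≤ 4 * (32 / c) * J.card * (1 / √((x : ℝ) + 1) * (1 / √(y : ℝ))) := by
      have : (0 : ℝ) ≤ J.card := Nat.cast_nonneg _
      positivity
    refine le_trans (le_of_eq ?_) (mul_le_mul_of_nonneg_left hq hA)
    field_simp
    ring

/-! ### Windows and their first points -/

theorem mem_points {U m : ℕ} {s : Fin (m + 2) → Fin (U + 2)} {p : ℕ} :
    p ∈ points s ↔ ∃ i : Fin m, (s i.succ.castSucc : ℕ) = p := by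
  simp [points]

/-- The indices of the at most `n` gaps that follow the point `s_{i+1}`. -/
def nextGaps {m : ℕ} (n : ℕ) (i : Fin m) : Finset (Fin (m + 1)) :=
  Finset.univ.filter fun j => (i : ℕ) + 1 ≤ j ∧ (j : ℕ) < min (i + 1 + n) (m + 1)

theorem castSucc_notMem_nextGaps {m n : ℕ} (i : Fin m) : i.castSucc ∉ nextGaps n i := by
  simp [nextGaps]

theorem card_nextGaps_le {m n : ℕ} (i : Fin m) : (nextGaps n i).card ≤ n := by
  rw [nextGaps, card_filter_Ico (min_le_right _ _)]
  omega

/-- A window of length `L` inside `[1, U]` that contains at least one and at most `n` points starts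
in the gap before its first point, and the next `n` gaps reach beyond its end. -/
theorem exists_first_point {U m L n : ℕ} {s : Fin (m + 2) → Fin (U + 2)} (hs : s ∈ configs U m)
    {a : ℤ} (ha : 0 < a) (haU : a + L ≤ U + 1)
    (h0 : 0 < ((points s).filter fun p : ℕ => a ≤ p ∧ (p : ℤ) < a + L).card)
    (hn : ((points s).filter fun p : ℕ => a ≤ p ∧ (p : ℤ) < a + L).card ≤ n) :
    ∃ i : Fin m, ∃ x : ℕ, x < L ∧ x < gaps s i.castSucc ∧
      L - x ≤ ∑ j ∈ nextGaps n i, gaps s j ∧ ((s i.succ.castSucc : ℕ) : ℤ) - x = a := by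
  classical
  obtain ⟨hmono, hs0, hlast⟩ := mem_configs.1 hs
  obtain ⟨p, hp⟩ := Finset.card_pos.1 h0
  obtain ⟨hp1, hp2, hp3⟩ := Finset.mem_filter.1 hp
  obtain ⟨i0, rfl⟩ := mem_points.1 hp1
  -- The least index r with s_r ≥ a is nonzero, as s_0 = 0 < a, and is that of the first point in
  -- the window.
  have hex : ∃ r : ℕ, ∃ h : r < m + 2, a ≤ ((s ⟨r, h⟩ : ℕ) : ℤ) :=
    ⟨i0 + 1, by omega, hp2⟩
  obtain ⟨hr, har⟩ := Nat.find_spec hex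
  have hmin : Nat.find hex ≤ i0 + 1 := Nat.find_min' hex ⟨by omega, hp2⟩
  have hprev (k : ℕ) (hk : k < Nat.find hex) (h : k < m + 2) : ((s ⟨k, h⟩ : ℕ) : ℤ) < a := by
    by_contra hcon
    exact Nat.find_min hex hk ⟨h, not_lt.1 hcon⟩
  generalize Nat.find hex = r at *
  have hzero : (s ⟨0, by omega⟩ : ℕ) = 0 := congrArg Fin.val hs0
  have hend : (s ⟨m + 1, by omega⟩ : ℕ) = U + 1 := congrArg Fin.val hlast
  obtain ⟨i, rfl⟩ : ∃ i, r = i + 1 := by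
    refine Nat.exists_eq_succ_of_ne_zero fun h => ?_
    subst h
    omega
  have hsr : (s ⟨i + 1, hr⟩ : ℕ) ≤ s i0.succ.castSucc :=
    hmono.monotone (show (⟨i + 1, hr⟩ : Fin (m + 2)) ≤ i0.succ.castSucc from hmin)
  have him : i < m := by omega
  have hgap : (s ⟨i, by omega⟩ : ℕ) + gaps s ⟨i, by omega⟩ = s ⟨i + 1, hr⟩ :=
    add_gaps hmono ⟨i, by omega⟩
  have hlt := hprev i (Nat.lt_succ_self i) (by omega)
  refine ⟨⟨i, him⟩, ((s ⟨i + 1, hr⟩ : ℕ) - a).toNat, by omega, ?_, ?_, ?_⟩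
  · change _ < gaps s ⟨i, by omega⟩
    omega
  · have hsum := add_sum_gaps hmono (i := i + 1) (r := min (i + 1 + n) (m + 1)) (by omega)
      (by omega)
    have hle : a + L ≤ ((s ⟨min (i + 1 + n) (m + 1), by omega⟩ : ℕ) : ℤ) := by
      -- Either the gaps run up to the sentinel U + 1, beyond the window by `haU`, or falling short
      -- of its end would put n + 1 points inside.
      rcases le_or_gt (m + 1) (i + 1 + n) with hc | hc
      · simp only [min_eq_right hc, hend]
        exact_mod_cast haU
      · simp only [min_eq_left hc.le]
        by_contra hcon
        have hcard : n + 1 ≤ ((points s).filter fun p : ℕ => a ≤ p ∧ (p : ℤ) < a + L).card := by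
          rw [← Fintype.card_fin (n + 1), ← Finset.card_univ]
          refine Finset.card_le_card_of_injOn
            (fun k : Fin (n + 1) => (s ⟨i + 1 + k, by omega⟩ : ℕ)) ?_ ?_
          · intro k _
            have h1 : (s ⟨i + 1, hr⟩ : ℕ) ≤ s ⟨i + 1 + k, by omega⟩ :=
              hmono.monotone (show (⟨i + 1, hr⟩ : Fin (m + 2)) ≤ ⟨i + 1 + k, by omega⟩ from
                Nat.le_add_right _ _)
            have h2 : (s ⟨i + 1 + k, by omega⟩ : ℕ) ≤ s ⟨i + 1 + n, by omega⟩ :=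
              hmono.monotone (show (⟨i + 1 + k, _⟩ : Fin (m + 2)) ≤ ⟨i + 1 + n, by omega⟩ from
                Nat.add_le_add_left (Nat.lt_succ_iff.1 k.2) _)
            refine Finset.mem_coe.2 (Finset.mem_filter.2 ⟨mem_points.2 ⟨⟨i + k, by omega⟩, ?_⟩, ?_⟩)
            · congr 2
              ext
              simp only [Fin.val_castSucc, Fin.val_succ]
              omega
            · beta_reduce
              constructor <;> omega
          · intro k _ k' _ h
            have h1 := hmono.injective (Fin.ext h)
            rw [Fin.mk.injEq] at h1
            exact Fin.ext (by omega)
        omega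
    change _ ≤ ∑ j ∈ Finset.univ.filter (fun j : Fin (m + 1) =>
      i + 1 ≤ (j : ℕ) ∧ (j : ℕ) < min (i + 1 + n) (m + 1)), gaps s j
    omega
  · change ((s ⟨i + 1, hr⟩ : ℕ) : ℤ) - _ = a
    omega

theorem sum_smallIntervals_le {U m L : ℕ} {l : ℝ} (hL : 0 < L) (hl : 0 < l)
    {s : Fin (m + 2) → Fin (U + 2)} (hs : s ∈ configs U m) :
    ∑ Δ ∈ Finset.Icc 1 L, smallIntervals U L l (points s) Δ ≤
      2 * L + ∑ i : Fin m, ∑ x ∈ Finset.range L,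
        if x < gaps s i.castSucc ∧ L - x ≤ ∑ j ∈ nextGaps ⌊l⌋₊ i, gaps s j then 1 else 0 := by
  classical
  obtain ⟨hmono, hs0, hlast⟩ := mem_configs.1 hs
  set Γ := ((Finset.univ : Finset (Fin m)) ×ˢ Finset.range L).filter fun z =>
    z.2 < gaps s z.1.castSucc ∧ L - z.2 ≤ ∑ j ∈ nextGaps ⌊l⌋₊ z.1, gaps s j with hΓ
  have hΓcard : ∑ i : Fin m, ∑ x ∈ Finset.range L,
      (if x < gaps s i.castSucc ∧ L - x ≤ ∑ j ∈ nextGaps ⌊l⌋₊ i, gaps s j then 1 else 0) =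
        Γ.card := by
    rw [hΓ, Finset.card_filter, Finset.sum_product]
  set P := (Finset.Icc 1 L ×ˢ Finset.Icc (-1 : ℤ) ((U / L : ℕ) : ℤ)).filter fun z =>
    l / 2 ≤ (intervalCount (points s) L z.1 z.2 : ℝ) ∧
      (intervalCount (points s) L z.1 z.2 : ℝ) ≤ l with hP
  have hPcard : ∑ Δ ∈ Finset.Icc 1 L, smallIntervals U L l (points s) Δ = P.card := by
    rw [hP, Finset.card_filter, Finset.sum_product]
    refine Finset.sum_congr rfl fun Δ _ => ?_
    rw [smallIntervals, Finset.card_filter]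
  rw [hΓcard, hPcard]
  -- Possible window starts: those overhanging on the left, on the right, and those encoded by a
  -- first point and an offset.
  set V : Finset ℤ := (Finset.Icc (1 - (L : ℤ)) 0 ∪ Finset.Icc ((U : ℤ) + 2 - L) U) ∪
    Γ.image fun z => ((s z.1.succ.castSucc : ℕ) : ℤ) - z.2 with hV
  have hVcard : V.card ≤ 2 * L + Γ.card := by
    refine (Finset.card_union_le _ _).trans (add_le_add ?_ Finset.card_image_le)
    refine (Finset.card_union_le _ _).trans ?_
    rw [Int.card_Icc, Int.card_Icc]
    omega
  refine le_trans ?_ hVcard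
  refine Finset.card_le_card_of_injOn (fun z => (z.1 : ℤ) + z.2 * L) ?_ ?_
  · rintro ⟨Δ, j⟩ hz
    obtain ⟨-, h1, h2⟩ := Finset.mem_filter.1 (Finset.mem_coe.1 hz)
    have hcount : intervalCount (points s) L Δ j = ((points s).filter fun p : ℕ =>
        (Δ : ℤ) + j * L ≤ p ∧ (p : ℤ) < (Δ : ℤ) + j * L + L).card := by
      rw [intervalCount]
      congr 2
      funext p
      rw [add_mul, one_mul, add_assoc]
    simp only at h1 h2
    rw [hcount] at h1 h2
    simp only
    generalize (Δ : ℤ) + j * L = a at *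
    have hn := Nat.le_floor h2
    -- The threshold l/2 serves only to make the window nonempty.
    have h0 : 0 < ((points s).filter fun p : ℕ => a ≤ p ∧ (p : ℤ) < a + L).card := by
      have : (0 : ℝ) < (((points s).filter fun p : ℕ => a ≤ p ∧ (p : ℤ) < a + L).card : ℝ) := by
        linarith
      exact_mod_cast this
    obtain ⟨p, hp⟩ := Finset.card_pos.1 h0
    obtain ⟨hp1, hp2, hp3⟩ := Finset.mem_filter.1 hp
    obtain ⟨i0, rfl⟩ := mem_points.1 hp1
    have hpos : (s 0 : ℕ) < s i0.succ.castSucc :=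
      hmono (show (0 : Fin (m + 2)) < i0.succ.castSucc from Nat.succ_pos _)
    have hltU : (s i0.succ.castSucc : ℕ) < s (Fin.last (m + 1)) :=
      hmono (Fin.castSucc_lt_last _)
    rw [hlast, Fin.val_last] at hltU
    rw [Finset.mem_coe, hV, Finset.mem_union, Finset.mem_union, Finset.mem_Icc, Finset.mem_Icc]
    rcases le_or_gt a 0 with ha | ha
    · exact Or.inl (Or.inl ⟨by omega, ha⟩)
    rcases le_or_gt (a + L) (U + 1) with haU | haU
    · obtain ⟨i, x, hx1, hx2, hx3, hx4⟩ := exists_first_point hs ha haU h0 hn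
      refine Or.inr (Finset.mem_image.2 ⟨(i, x), Finset.mem_filter.2 ⟨?_, hx2, hx3⟩, hx4⟩)
      exact Finset.mem_product.2 ⟨Finset.mem_univ _, Finset.mem_range.2 hx1⟩
    · exact Or.inl (Or.inr ⟨by omega, by omega⟩)
  · rintro ⟨Δ, j⟩ hz ⟨Δ', j'⟩ hz' h
    have h1 := (Finset.mem_product.1 (Finset.mem_filter.1 (Finset.mem_coe.1 hz)).1).1
    have h1' := (Finset.mem_product.1 (Finset.mem_filter.1 (Finset.mem_coe.1 hz')).1).1
    rw [Finset.mem_Icc] at h1 h1'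
    simp only at h h1 h1'
    have hL' : (0 : ℤ) < L := by exact_mod_cast hL
    -- Δ lies in a range of L consecutive integers, so Δ + jL determines j.
    have hj : j = j' := by
      rcases lt_trichotomy j j' with hlt | heq | hgt
      · have := mul_le_mul_of_nonneg_right (Int.add_one_le_of_lt hlt) hL'.le
        rw [add_mul, one_mul] at this
        omega
      · exact heq
      · have := mul_le_mul_of_nonneg_right (Int.add_one_le_of_lt hgt) hL'.le
        rw [add_mul, one_mul] at this
        omega
    subst hj
    rw [Prod.mk.injEq]
    exact ⟨by omega, rfl⟩

/-! ### Bounds on the expectation -/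

theorem expectedSmallIntervals_le_of_forall {U m L : ℕ} {l c : ℝ} (hmU : m ≤ U) (hL : 0 < L)
    (h : ∀ s ∈ configs U m, ∀ Δ ∈ Finset.Icc 1 L, (smallIntervals U L l (points s) Δ : ℝ) ≤ c) :
    expectedSmallIntervals U m L l ≤ c := by
  have hL' : (0 : ℝ) < L := by exact_mod_cast hL
  calc expectedSmallIntervals U m L l ≤ ∑ s ∈ configs U m, pr s * c := by
        refine Finset.sum_le_sum fun s hs => mul_le_mul_of_nonneg_left ?_ (pr_nonneg s)
        rw [div_le_iff₀ hL']
        refine (Finset.sum_le_sum (h s hs)).trans_eq ?_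
        rw [Finset.sum_const, Nat.card_Icc, Nat.add_sub_cancel, nsmul_eq_mul, mul_comm]
    _ = c := by rw [← Finset.sum_mul, sum_pr hmU, one_mul]

theorem smallIntervals_le (U L : ℕ) (l : ℝ) (S : Finset ℕ) (Δ : ℕ) :
    (smallIntervals U L l S Δ : ℝ) ≤ (U : ℝ) / L + 2 := by
  have h1 : smallIntervals U L l S Δ ≤ U / L + 2 := by
    refine (Finset.card_filter_le _ _).trans ?_
    rw [Int.card_Icc]
    generalize U / L = q
    omega
  have h2 : (smallIntervals U L l S Δ : ℝ) ≤ ((U / L : ℕ) : ℝ) + 2 := by exact_mod_cast h1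
  have h3 : ((U / L : ℕ) : ℝ) ≤ (U : ℝ) / L := Nat.cast_div_le
  linarith

theorem exists_expectedSmallIntervals_le {α β : ℝ} (hα : 0 < α) (hβ : 0 < β) :
    ∃ K : ℝ, 0 < K ∧ ∀ (m U L : ℕ) (l : ℝ), 0 < m → m ≤ U → α * (m : ℝ) ^ 2 ≤ U →
      (U : ℝ) ≤ β * (m : ℝ) ^ 2 → 0 < L → 0 < l → 2 * l ≤ m →
      expectedSmallIntervals U m L l ≤ 2 + K * (m * l / L) := by
  obtain ⟨K, hK, hblock⟩ := exists_sum_pr_gap_block_le hα hβ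
  refine ⟨6 * K, by positivity, ?_⟩
  intro m U L l hm hmU h1 h2 hL hl hlm
  have hL' : (0 : ℝ) < L := by exact_mod_cast hL
  have hfloor : (⌊l⌋₊ : ℝ) ≤ l := Nat.floor_le hl.le
  have hcard (i : Fin m) : ((nextGaps ⌊l⌋₊ i).card : ℝ) ≤ l :=
    le_trans (by exact_mod_cast card_nextGaps_le i) hfloor
  have hterm (i : Fin m) : ∑ x ∈ Finset.range L, ∑ s ∈ configs U m, pr s *
      (if x < gaps s i.castSucc ∧ L - x ≤ ∑ j ∈ nextGaps ⌊l⌋₊ i, gaps s j then 1 else 0) ≤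
        6 * K * l := by
    have h2card : 2 * (nextGaps ⌊l⌋₊ i).card ≤ m := by
      have : 2 * ((nextGaps ⌊l⌋₊ i).card : ℝ) ≤ m := by linarith [hcard i]
      exact_mod_cast this
    calc _ ≤ ∑ x ∈ Finset.range L,
          K * l * (1 / √((x : ℝ) + 1) * (1 / √((L - x : ℕ) : ℝ))) := by
          refine Finset.sum_le_sum fun x hx => ?_
          have hx' := Finset.mem_range.1 hx
          refine (hblock m U hm hmU h1 h2 i.castSucc _ (castSucc_notMem_nextGaps i) h2card x
            (L - x) (by omega)).trans ?_
          exact mul_le_mul_of_nonneg_right (mul_le_mul_of_nonneg_left (hcard i) hK.le)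
            (by positivity)
      _ ≤ K * l * 6 := by
        rw [← Finset.mul_sum]
        exact mul_le_mul_of_nonneg_left (sum_one_div_sqrt_mul_sqrt_le L) (by positivity)
      _ = 6 * K * l := by ring
  have hsum : ∑ s ∈ configs U m,
      pr s * ∑ Δ ∈ Finset.Icc 1 L, (smallIntervals U L l (points s) Δ : ℝ) ≤
        2 * L + m * (6 * K * l) := by
    calc _ ≤ ∑ s ∈ configs U m, pr s * (2 * L + ∑ i : Fin m, ∑ x ∈ Finset.range L,
          if x < gaps s i.castSucc ∧ L - x ≤ ∑ j ∈ nextGaps ⌊l⌋₊ i, gaps s j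
            then (1 : ℝ) else 0) := by
          refine Finset.sum_le_sum fun s hs => mul_le_mul_of_nonneg_left ?_ (pr_nonneg s)
          exact_mod_cast sum_smallIntervals_le hL hl hs
      _ = 2 * L + ∑ i : Fin m, ∑ x ∈ Finset.range L, ∑ s ∈ configs U m, pr s *
          (if x < gaps s i.castSucc ∧ L - x ≤ ∑ j ∈ nextGaps ⌊l⌋₊ i, gaps s j
            then 1 else 0) := by
        simp_rw [mul_add, Finset.sum_add_distrib]
        rw [← Finset.sum_mul, sum_pr hmU, one_mul]
        congr 1
        simp_rw [Finset.mul_sum]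
        rw [Finset.sum_comm]
        exact Finset.sum_congr rfl fun i _ => Finset.sum_comm
      _ ≤ 2 * L + ∑ _i : Fin m, 6 * K * l := by
        gcongr with i
        exact hterm i
      _ = 2 * L + m * (6 * K * l) := by simp
  have hE : expectedSmallIntervals U m L l = (∑ s ∈ configs U m,
      pr s * ∑ Δ ∈ Finset.Icc 1 L, (smallIntervals U L l (points s) Δ : ℝ)) / L := by
    rw [expectedSmallIntervals, Finset.sum_div]
    exact Finset.sum_congr rfl fun s _ => by rw [mul_div_assoc]
  rw [hE, div_le_iff₀ hL']
  refine hsum.trans_eq ?_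
  field_simp

end CatalanBlock

theorem mainTheorem6 (b α β : ℝ) (hb : 1 < b) (hα : 0 < α) (hαβ : α ≤ β) :
    ∃ C : ℝ, 0 < C ∧ ∀ (B U m L : ℕ) (k l : ℝ),
      2 ≤ B → U ≤ B → m ≤ U →
      α * (m : ℝ) ^ 2 ≤ (U : ℝ) → (U : ℝ) ≤ β * (m : ℝ) ^ 2 →
      k = Real.logb b (B : ℝ) ^ 4 →
      L = ⌊(m : ℝ) ^ 2 / k⌋₊ → 1 ≤ L →
      0 < l → l ≤ (m : ℝ) / √k →
      CatalanBlock.expectedSmallIntervals U m L l ≤ C * (l * k / (m : ℝ) + 1) := by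
  have hβ : 0 < β := hα.trans_le hαβ
  obtain ⟨K, hK, hmain⟩ := CatalanBlock.exists_expectedSmallIntervals_le hα hβ
  -- 8β + 2 bounds the number of intervals when k < 4; 2 + 2K serves k ≥ 4.
  refine ⟨8 * β + 2 + 2 * K, by positivity, ?_⟩
  intro B U m L k l hB _ hmU h1 h2 hk hL hL1 hl hlm
  have hk0 : 0 < k := by
    have : 0 < Real.logb b (B : ℝ) := Real.logb_pos hb (by exact_mod_cast hB)
    rw [hk]
    positivity
  have hm : 0 < m := by
    rcases Nat.eq_zero_or_pos m with rfl | h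
    · simp at hL
      omega
    · exact h
  have hm' : (0 : ℝ) < m := by exact_mod_cast hm
  have hL' : (1 : ℝ) ≤ L := by exact_mod_cast hL1
  -- As L ≥ 1, rounding down loses at most a factor 2.
  have hLlow : (m : ℝ) ^ 2 ≤ 2 * k * L := by
    have h := Nat.lt_floor_add_one ((m : ℝ) ^ 2 / k)
    rw [← hL, div_lt_iff₀ hk0] at h
    nlinarith
  have hpos : 0 ≤ l * k / (m : ℝ) := by positivity
  -- k ≥ 4 is what turns l ≤ m/√k into 2l ≤ m.
  rcases le_or_gt 4 k with hk4 | hk4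
  · have hsqrt : 2 ≤ √k := Real.le_sqrt_of_sq_le (by norm_num; exact hk4)
    have hl2 : 2 * l ≤ m := by
      rw [le_div_iff₀ (by positivity)] at hlm
      nlinarith
    have hbound : (m : ℝ) * l / L ≤ 2 * (l * k / m) := by
      rw [mul_div_assoc', div_le_div_iff₀ (by positivity) hm']
      nlinarith
    calc CatalanBlock.expectedSmallIntervals U m L l ≤ 2 + K * (m * l / L) :=
          hmain m U L l hm hmU h1 h2 hL1 hl hl2
      _ ≤ 2 + K * (2 * (l * k / m)) := by gcongr
      _ ≤ (8 * β + 2 + 2 * K) * (l * k / m + 1) := by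
        have : 0 ≤ (8 * β + 2) * (l * k / m) := by positivity
        nlinarith
  · calc CatalanBlock.expectedSmallIntervals U m L l ≤ (U : ℝ) / L + 2 :=
          CatalanBlock.expectedSmallIntervals_le_of_forall hmU hL1 fun s _ Δ _ =>
            CatalanBlock.smallIntervals_le U L l _ Δ
      _ ≤ 8 * β + 2 := by
        have : (U : ℝ) / L ≤ 8 * β := by
          rw [div_le_iff₀ (by positivity)]
          calc (U : ℝ) ≤ β * (m : ℝ) ^ 2 := h2
            _ ≤ β * (2 * k * L) := by gcongr
            _ ≤ β * (2 * 4 * L) := by gcongr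
            _ = 8 * β * L := by ring
        linarith
      _ ≤ (8 * β + 2 + 2 * K) * (l * k / m + 1) := by
        have : 0 ≤ (8 * β + 2 + 2 * K) * (l * k / m) := by positivity
        nlinarith
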